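/- For a positive integer $n$, a (labeled) silhouette graph of size $n$ is a pair $(\sigma_2,\sigma_3)$ of fixpoint-free permutations of $[n]=\{1,\dots,n\}$ with $\sigma_2^2=1$ and $\sigma_3^3=1$, such that the graph on $[n]$ with an undirected $a$-edge between $v$ and $\sigma_2(v)$ and a directed $b$-edge from $v$ to $\sigma_3(v)$, for each $v\in[n]$, is connected. An $ab$-cycle of size $m$ in this graph is an orbit with exactly $m$ elements of the map $v\mapsto\sigma_3(\sigma_2(v))$, which follows an $a$-edge and then a $b$-edge. Let $0<\alpha<\frac16$. There is a constant $C>0$, depending only on $\alpha$, such that for every positive multiple $n$ of $6$, a silhouette graph of size $n$ chosen uniformly at random has an $ab$-cycle of size at least $2$ and at most $n^{\alpha}$ with probability at least $1-C\,n^{-\alpha}$. -/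

import Mathlib

/-- A labeled silhouette graph of size `n`, with vertex set `Fin n`. Every vertex `v` lies on exactly
one undirected `a`-edge, which joins `v` to `a v ≠ v`, and on exactly one directed `b`-triangle
`v → b v → b (b v) → v`; there are no loops and no isolated `b`-edges, and the graph is
connected. -/
@[ext]
structure SilhouetteGraph (n : ℕ) where
  /-- the fixpoint-free involution given by the `a`-edges -/
  a : Equiv.Perm (Fin n)
  /-- the fixpoint-free permutation of order 3 given by the `b`-edges -/
  b : Equiv.Perm (Fin n)
  a_sq : a ^ 2 = 1
  a_ne : ∀ v, a v ≠ v
  b_cube : b ^ 3 = 1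
  b_ne : ∀ v, b v ≠ v
  connected : (SimpleGraph.fromRel fun u v => a u = v ∨ b u = v).Connected

namespace SilhouetteGraph

/-- For each size there are finitely many labeled silhouette graphs. -/
instance instFinite (n : ℕ) : Finite (SilhouetteGraph n) :=
  Finite.of_injective (fun G : SilhouetteGraph n => (G.a, G.b)) fun G H h => by
    simp only [Prod.mk.injEq] at h
    exact SilhouetteGraph.ext h.1 h.2

/-- The vertex reached from `v` by reading the word `ab`: first the `a`-edge at `v`, then the
outgoing `b`-edge. -/
def abStep {n : ℕ} (G : SilhouetteGraph n) (v : Fin n) : Fin n := G.b (G.a v)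

/-- `G` has an `ab`-cycle of size `m`: from some vertex `v`, reading `(ab)^m` leads back to `v` and
`m` is the least positive integer with this property (that is, `abStep` has an orbit with exactly
`m` elements). -/
def HasABCycle {n : ℕ} (G : SilhouetteGraph n) (m : ℕ) : Prop :=
  0 < m ∧ ∃ v : Fin n, Function.minimalPeriod G.abStep v = m

/-- The probability of the event `E` for a uniformly random labeled silhouette graph of size `n`. -/
noncomputable def prob (n : ℕ) (E : Set (SilhouetteGraph n)) : ℝ :=
  (E.ncard : ℝ) / (Nat.card (SilhouetteGraph n) : ℝ)

end SilhouetteGraph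

/-! Fix the permutation `b = π`; its orbits are triangles, and `a` is then a uniform perfect
matching. Let N be the number of matchings, n the number of vertices, and N_m the number of
matchings without `ab`-cycles of size 2, …, m. The engine is the switching inequality n N_m ≤ n m
(N_{m-1} - N_m) + 104 m² N (`card_noShort_step`).

Given a matching counted by N_m and a vertex x, let p be the end of the `ab`-path with m vertices
from x. Replacing the edges at p and π⁻¹ x by an edge joining these two, and an edge joining their
former partners, closes the path into a cycle of size m. Typically no other short cycle appears. The
new matching, the point x on its m-cycle (m choices) and the former partner of p (at most n choices)
determine the original pair. Atypical pairs force one of three walks of length O(m) to revisit a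
triangle. A second switching bounds the probability that a walk of length L does so by 6L²/n
(`card_not_spread_le`).

Rearranged, (m+1) N_m ≤ m N_{m-1} + 104 m² N/n. This telescopes from N_1 = N to (M+1) N_M ≤ (2 + 104
M³/n) N, which is at most 106 N when M³ ≤ n (`card_noShort_le`).

Connectedness costs only a factor 2: by exact counts of fixpoint-free roots of the identity and a
union bound over invariant vertex sets, at least half of all pairs are connected
(`two_mul_card_not_connected_le`). -/

open Equiv

set_option linter.unusedSectionVars false

/-! ### Switchings of matchings, and walks in a random matching -/

section Switching

variable {V : Type*} [Fintype V] [DecidableEq V]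

/-- The fixpoint-free `p`-th roots of the identity permutation. -/
def fpfRoots (p : ℕ) (V : Type*) [Fintype V] [DecidableEq V] : Finset (Perm V) :=
  Finset.univ.filter fun σ => σ ^ p = 1 ∧ ∀ v, σ v ≠ v

lemma mem_fpfRoots {p : ℕ} {σ : Perm V} : σ ∈ fpfRoots p V ↔ σ ^ p = 1 ∧ ∀ v, σ v ≠ v := by
  simp [fpfRoots]

/-- The fixpoint-free involutions of `V`. -/
abbrev fpfInvolutions (V : Type*) [Fintype V] [DecidableEq V] : Finset (Perm V) :=
  fpfRoots 2 V

lemma apply_apply_of_mem {a : Perm V} (ha : a ∈ fpfInvolutions V) (v : V) : a (a v) = v := by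
  have h := (mem_fpfRoots.1 ha).1
  rw [← Perm.mul_apply, ← sq, h, Perm.one_apply]

lemma apply_ne_of_mem {a : Perm V} (ha : a ∈ fpfInvolutions V) (v : V) : a v ≠ v :=
  (mem_fpfRoots.1 ha).2 v

/-- Replace the edges at `p` and at `q` of the matching `a` by the edge `pq` and an edge joining the
former partners. -/
def switch (a : Perm V) (p q : V) : Perm V := swap (a p) q * a * swap (a p) q

lemma switch_mem {a : Perm V} (ha : a ∈ fpfInvolutions V) (p q : V) :
    switch a p q ∈ fpfInvolutions V := by
  rw [mem_fpfRoots]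
  constructor
  · ext v
    simp only [switch, sq, Perm.mul_apply, swap_apply_self, apply_apply_of_mem ha, Perm.one_apply]
  · intro v h
    simp only [switch, Perm.mul_apply] at h
    apply apply_ne_of_mem ha (swap (a p) q v)
    rw [swap_apply_eq_iff] at h
    exact h

lemma switch_apply_left {a : Perm V} (ha : a ∈ fpfInvolutions V) {p q : V} (h : p ≠ q) :
    switch a p q p = q := by
  have := apply_ne_of_mem ha p
  simp only [switch, Perm.mul_apply]
  rw [swap_apply_of_ne_of_ne this.symm h, swap_apply_left]

lemma switch_apply_right {a : Perm V} (ha : a ∈ fpfInvolutions V) {p q : V} (h : p ≠ q) :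
    switch a p q q = p := by
  have := apply_apply_of_mem (switch_mem ha p q) p
  rwa [switch_apply_left ha h] at this

lemma switch_apply_partner {a : Perm V} (ha : a ∈ fpfInvolutions V) {p q : V} (h : p ≠ q) :
    switch a p q (a p) = a q := by
  simp only [switch, Perm.mul_apply]
  rw [swap_apply_left, swap_apply_of_ne_of_ne (by simpa using h.symm) (apply_ne_of_mem ha q)]

lemma switch_apply_partner' {a : Perm V} (ha : a ∈ fpfInvolutions V) {p q : V} (h : p ≠ q) :
    switch a p q (a q) = a p := by
  rw [← switch_apply_partner ha h, apply_apply_of_mem (switch_mem ha p q)]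

lemma switch_apply_of_ne {a : Perm V} (ha : a ∈ fpfInvolutions V) {p q v : V} (hp : v ≠ p)
    (hq : v ≠ q) (hap : v ≠ a p) (haq : v ≠ a q) : switch a p q v = a v := by
  simp only [switch, Perm.mul_apply]
  rw [swap_apply_of_ne_of_ne hap hq, swap_apply_of_ne_of_ne (by simpa using hp)]
  intro h
  apply haq
  rw [← h, apply_apply_of_mem ha]

/-- Switchings are reversible once `p` and its old partner are remembered; every injectivity
argument below rests on this. -/
lemma switch_switch {a : Perm V} (ha : a ∈ fpfInvolutions V) {p q : V} (h : p ≠ q) :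
    switch (switch a p q) p (a p) = a := by
  rw [switch, switch_apply_left ha h, switch, swap_comm q (a p)]
  ext v
  simp [Perm.mul_apply]

/-! ### Walks -/

/-- The walk that alternately follows `a` and turns by `t i`. -/
def walk (a : Perm V) (t : ℕ → Perm V) : ℕ → Perm V
  | 0 => 1
  | i + 1 => t i * a * walk a t i

@[simp] lemma walk_zero (a : Perm V) (t : ℕ → Perm V) (s : V) : walk a t 0 s = s := rfl

lemma walk_succ (a : Perm V) (t : ℕ → Perm V) (i : ℕ) (s : V) :
    walk a t (i + 1) s = t i (a (walk a t i s)) := rfl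

/-- The orbit of `v` under a permutation of order three. -/
def tri (π : Perm V) (v : V) : Finset V := {v, π v, π⁻¹ v}

lemma mem_tri {π : Perm V} {u v : V} : u ∈ tri π v ↔ u = v ∨ u = π v ∨ u = π⁻¹ v := by
  simp [tri]

lemma self_mem_tri (π : Perm V) (v : V) : v ∈ tri π v := by simp [tri]

lemma card_tri_le (π : Perm V) (v : V) : (tri π v).card ≤ 3 := Finset.card_le_three

lemma apply_apply_eq_inv {π : Perm V} (hπ : π ^ 3 = 1) (v : V) : π (π v) = π⁻¹ v := by
  have h : π * π = π⁻¹ := by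
    rw [eq_inv_iff_mul_eq_one, ← hπ, pow_succ, sq]
  rw [← h, Perm.mul_apply]

lemma inv_inv_eq_apply {π : Perm V} (hπ : π ^ 3 = 1) (v : V) : π⁻¹ (π⁻¹ v) = π v := by
  rw [← apply_apply_eq_inv hπ]; simp

lemma mem_tri_symm {π : Perm V} {u v : V} : u ∈ tri π v ↔ v ∈ tri π u := by
  have key : ∀ u v : V, u ∈ tri π v → v ∈ tri π u := by
    intro u v h
    rw [mem_tri] at *
    rcases h with rfl | rfl | rfl <;> simp
  exact ⟨key u v, key v u⟩

lemma mem_tri_trans {π : Perm V} (hπ : π ^ 3 = 1) {u v w : V} (h₁ : u ∈ tri π v)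
    (h₂ : v ∈ tri π w) : u ∈ tri π w := by
  have e₁ : π⁻¹ (π w) = w := by simp
  have e₂ : π (π⁻¹ w) = w := by simp
  rw [mem_tri] at *
  rcases h₁ with rfl | rfl | rfl <;> rcases h₂ with rfl | rfl | rfl <;>
    simp only [apply_apply_eq_inv hπ, inv_inv_eq_apply hπ, e₁, e₂, true_or, or_true]

/-- The turns of a non-backtracking walk. -/
def IsTurn (π : Perm V) (t : ℕ → Perm V) : Prop := ∀ i, t i = π ∨ t i = π⁻¹

lemma IsTurn.mem_tri {π : Perm V} {t : ℕ → Perm V} (ht : IsTurn π t) (i : ℕ) (v : V) :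
    t i v ∈ tri π v := by
  rw [_root_.mem_tri]
  rcases ht i with h | h <;> simp [h]

lemma IsTurn.ne {π : Perm V} (hf : ∀ v, π v ≠ v) {t : ℕ → Perm V} (ht : IsTurn π t) (i : ℕ)
    (v : V) : t i v ≠ v := by
  rcases ht i with h | h <;> rw [h]
  · exact hf v
  · rw [Ne, Perm.inv_eq_iff_eq]; exact (hf v).symm

/-- The first `L + 1` vertices of the walk lie in distinct triangles. -/
def Spread (π a : Perm V) (t : ℕ → Perm V) (L : ℕ) (s : V) : Prop :=
  ∀ i j, i < j → j ≤ L → walk a t j s ∉ tri π (walk a t i s)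

lemma Spread.ne {π a : Perm V} {t : ℕ → Perm V} {L : ℕ} {s : V} (h : Spread π a t L s)
    (hπ : π ^ 3 = 1) {i j : ℕ} (hij : i ≠ j) (hi : i ≤ L) (hj : j ≤ L) {u v : V}
    (hu : u ∈ tri π (walk a t i s)) (hv : v ∈ tri π (walk a t j s)) : u ≠ v := by
  rintro rfl
  have h1 := mem_tri_trans hπ (mem_tri_symm.1 hv) hu
  rcases lt_or_gt_of_ne hij with h' | h'
  · exact h i j h' hj h1
  · exact h j i h' hi (mem_tri_symm.1 h1)

/-- The union of the triangles visited in the first `l` steps. -/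
def visited (π a : Perm V) (t : ℕ → Perm V) (l : ℕ) (s : V) : Finset V :=
  (Finset.range (l + 1)).biUnion fun i => tri π (walk a t i s)

lemma card_visited_le (π a : Perm V) (t : ℕ → Perm V) (l : ℕ) (s : V) :
    (visited π a t l s).card ≤ 3 * (l + 1) := by
  refine (Finset.card_biUnion_le_card_mul _ _ 3 fun i _ => card_tri_le _ _).trans ?_
  rw [Finset.card_range, mul_comm]

lemma walk_mem_visited (π a : Perm V) (t : ℕ → Perm V) {i l : ℕ} (h : i ≤ l) (s : V) :
    walk a t i s ∈ visited π a t l s :=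
  Finset.mem_biUnion.2 ⟨i, Finset.mem_range.2 (by omega), self_mem_tri _ _⟩

lemma walk_congr {a a' : Perm V} {t : ℕ → Perm V} {l : ℕ} {s : V}
    (h : ∀ i < l, a' (walk a t i s) = a (walk a t i s)) {i : ℕ} (hi : i ≤ l) :
    walk a' t i s = walk a t i s := by
  induction i with
  | zero => rfl
  | succ i ih => rw [walk_succ, walk_succ, ih (by omega), h i (by omega)]

lemma visited_congr {π a a' : Perm V} {t : ℕ → Perm V} {l : ℕ} {s : V}
    (h : ∀ i ≤ l, walk a' t i s = walk a t i s) : visited π a' t l s = visited π a t l s := by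
  refine Finset.biUnion_congr rfl fun i hi => ?_
  rw [h i (by simpa [Nat.lt_succ_iff] using hi)]

open Classical in
/-- The matchings for which the walk from `s` first revisits a triangle at step `l + 1`. -/
noncomputable def firstCollision (π : Perm V) (t : ℕ → Perm V) (l : ℕ) (s : V) : Finset (Perm V) :=
  (fpfInvolutions V).filter fun a => Spread π a t l s ∧ a (walk a t l s) ∈ visited π a t l s

/-- Switch the colliding edge at the walk's end to a vertex `q` outside the visited triangles and
their `a`-images, which exclude at most 6(l+1) vertices. The walk up to step `l` survives, so the
old matching is recovered from the new one and the old partner of the end, which has at most 3(l+1)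
possible values. -/
lemma card_firstCollision_mul_le {π : Perm V} (hπ : π ^ 3 = 1) (hf : ∀ v, π v ≠ v)
    {t : ℕ → Perm V} (ht : IsTurn π t) (l : ℕ) (s : V) :
    (firstCollision π t l s).card * (Fintype.card V - 6 * (l + 1)) ≤
      (fpfInvolutions V).card * (3 * (l + 1)) := by
  classical
  let free : Perm V → Finset V := fun a =>
    Finset.univ \ (visited π a t l s ∪ (visited π a t l s).image a)
  let S := (firstCollision π t l s).sigma free
  let T := (fpfInvolutions V).sigma fun a => visited π a t l s
  have hS : (firstCollision π t l s).card * (Fintype.card V - 6 * (l + 1)) ≤ S.card := by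
    rw [Finset.card_sigma, ← smul_eq_mul]
    refine Finset.card_nsmul_le_sum _ _ _ fun a _ => ?_
    have h1 := card_visited_le π a t l s
    have h2 : ((visited π a t l s).image a).card ≤ _ := Finset.card_image_le
    have h3 := Finset.card_union_le (visited π a t l s) ((visited π a t l s).image a)
    have h4 := Finset.le_card_sdiff (visited π a t l s ∪ (visited π a t l s).image a)
      (Finset.univ : Finset V)
    rw [Finset.card_univ] at h4
    simp only [free]
    omega
  have hT : T.card ≤ (fpfInvolutions V).card * (3 * (l + 1)) := by
    rw [Finset.card_sigma, ← smul_eq_mul]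
    exact Finset.sum_le_card_nsmul _ _ _ fun a _ => card_visited_le π a t l s
  refine hS.trans (le_trans ?_ hT)
  have key : ∀ a ∈ firstCollision π t l s, ∀ q ∈ free a,
      walk a t l s ≠ q ∧ ∀ i ≤ l, walk (switch a (walk a t l s) q) t i s = walk a t i s := by
    intro a ha q hq
    simp only [firstCollision, Finset.mem_filter] at ha
    obtain ⟨haI, hsp, hcol⟩ := ha
    simp only [free, Finset.mem_sdiff, Finset.mem_univ, true_and, Finset.mem_union,
      Finset.mem_image, not_or, not_exists, not_and] at hq
    have hne : ∀ i ≤ l, walk a t i s ≠ q := fun i hi h =>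
      hq.1 (h ▸ walk_mem_visited π a t hi s)
    refine ⟨hne l le_rfl, fun i hi => walk_congr (l := l) (fun i hi => ?_) hi⟩
    refine switch_apply_of_ne haI ?_ (hne i hi.le) ?_ ?_
    · exact hsp.ne hπ hi.ne hi.le le_rfl (self_mem_tri _ _) (self_mem_tri _ _)
    -- The walk would reach the triangle of its endpoint at step `i + 1`; spreading forces `i + 1 =
    -- l`, and then the turn would fix a vertex.
    · intro h
      have h1 : a (walk a t i s) = walk a t l s := by rw [h, apply_apply_of_mem haI]
      have h2 : a (walk a t i s) ∈ tri π (walk a t (i + 1) s) := by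
        rw [walk_succ]; exact mem_tri_symm.1 (ht.mem_tri _ _)
      by_cases hil : i + 1 = l
      · have h3 := ht.ne hf i (a (walk a t i s))
        rw [← walk_succ, hil] at h3
        exact h3 h1.symm
      · exact hsp.ne hπ hil (by omega) le_rfl h2 (self_mem_tri _ _) h1
    · intro h
      refine hq.2 (walk a t i s) (walk_mem_visited π a t hi.le s) ?_
      rw [h, apply_apply_of_mem haI]
  refine Finset.card_le_card_of_injOn
    (fun x => ⟨switch x.1 (walk x.1 t l s) x.2, x.1 (walk x.1 t l s)⟩) ?_ ?_
  · rintro ⟨a, q⟩ hx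
    simp only [S, Finset.coe_sigma, Set.mem_sigma_iff, Finset.mem_coe] at hx
    obtain ⟨h1, h2⟩ := key a hx.1 q hx.2
    have ha := hx.1
    simp only [firstCollision, Finset.mem_filter] at ha
    simp only [T, Finset.coe_sigma, Set.mem_sigma_iff, Finset.mem_coe]
    refine ⟨switch_mem ha.1 _ _, ?_⟩
    rw [visited_congr h2]
    exact ha.2.2
  · rintro ⟨a, q⟩ hx ⟨b, q'⟩ hy hxy
    simp only [S, Finset.coe_sigma, Set.mem_sigma_iff, Finset.mem_coe] at hx hy
    obtain ⟨h1, h2⟩ := key a hx.1 q hx.2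
    obtain ⟨h3, h4⟩ := key b hy.1 q' hy.2
    have ha := (Finset.mem_filter.1 hx.1).1
    have hb := (Finset.mem_filter.1 hy.1).1
    simp only [Sigma.mk.injEq, heq_eq_eq] at hxy
    obtain ⟨e1, e2⟩ := hxy
    have e3 : walk a t l s = walk b t l s := by
      rw [← h2 l le_rfl, ← h4 l le_rfl, e1]
    have e4 : a = b := by
      rw [← switch_switch ha h1, ← switch_switch hb h3, e1, e2, e3]
    subst e4
    have e5 : q = q' := by
      rw [← switch_apply_left ha h1, ← switch_apply_left ha h3, e1]
    rw [e5]

open Classical in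
/-- A random walk in a random matching is unlikely to revisit a triangle soon. -/
lemma card_not_spread_le {π : Perm V} (hπ : π ^ 3 = 1) (hf : ∀ v, π v ≠ v)
    {t : ℕ → Perm V} (ht : IsTurn π t) {L : ℕ} (hL : 2 ≤ L) (s : V) :
    Fintype.card V * ((fpfInvolutions V).filter fun a => ¬ Spread π a t L s).card ≤
      (fpfInvolutions V).card * (6 * L ^ 2) := by
  by_cases hn : Fintype.card V < 12 * L
  · have h1 := Finset.card_filter_le (fpfInvolutions V) fun a => ¬ Spread π a t L s
    calc _ ≤ (12 * L) * (fpfInvolutions V).card := Nat.mul_le_mul hn.le h1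
      _ = (fpfInvolutions V).card * (6 * (2 * L)) := by ring
      -- For small `V` the trivial bound suffices, since 2 ≤ `L` gives 12L ≤ 6L².
      _ ≤ _ := by rw [sq]; gcongr
  push Not at hn
  have hsub : ((fpfInvolutions V).filter fun a => ¬ Spread π a t L s) ⊆
      (Finset.range L).biUnion fun l => firstCollision π t l s := by
    intro a ha
    rw [Finset.mem_filter] at ha
    obtain ⟨haI, hns⟩ := ha
    have h0 : ∃ l, ¬ Spread π a t l s := ⟨L, hns⟩
    have hsp0 : Spread π a t 0 s := fun i j hij hj => by omega
    obtain ⟨l, hl⟩ : ∃ l, Nat.find h0 = l + 1 := by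
      apply Nat.exists_eq_succ_of_ne_zero
      intro h
      exact Nat.find_spec h0 (h ▸ hsp0)
    have hlL : l + 1 ≤ L := hl ▸ Nat.find_min' h0 hns
    have h1 : Spread π a t l s := by
      by_contra h
      have := Nat.find_min' h0 h
      omega
    have h2 : ¬ Spread π a t (l + 1) s := hl ▸ Nat.find_spec h0
    rw [Finset.mem_biUnion]
    refine ⟨l, Finset.mem_range.2 hlL, Finset.mem_filter.2 ⟨haI, h1, ?_⟩⟩
    unfold Spread at h2
    push Not at h2
    obtain ⟨i, j, hij, hj, hm⟩ := h2
    have hj' : j = l + 1 := by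
      by_contra h
      exact h1 i j hij (by omega) hm
    subst hj'
    refine Finset.mem_biUnion.2 ⟨i, Finset.mem_range.2 hij, ?_⟩
    refine mem_tri_trans hπ ?_ hm
    rw [walk_succ]
    exact mem_tri_symm.1 (ht.mem_tri _ _)
  have hc := (Finset.card_le_card hsub).trans Finset.card_biUnion_le
  have hl : ∀ l ∈ Finset.range L, Fintype.card V * (firstCollision π t l s).card ≤
      (fpfInvolutions V).card * (6 * L) := by
    intro l hl
    have hl := Finset.mem_range.1 hl
    have h := card_firstCollision_mul_le hπ hf ht l s
    -- At least half of the vertices remain free because 12L ≤ |V|.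
    have h1 : Fintype.card V ≤ 2 * (Fintype.card V - 6 * (l + 1)) := by omega
    calc _ ≤ 2 * (Fintype.card V - 6 * (l + 1)) * (firstCollision π t l s).card := by gcongr
      _ = 2 * ((firstCollision π t l s).card * (Fintype.card V - 6 * (l + 1))) := by ring
      _ ≤ 2 * ((fpfInvolutions V).card * (3 * (l + 1))) := by gcongr
      _ ≤ 2 * ((fpfInvolutions V).card * (3 * L)) := by gcongr; omega
      _ = _ := by ring
  calc _ ≤ Fintype.card V * ∑ l ∈ Finset.range L, (firstCollision π t l s).card := by gcongr
    _ = ∑ l ∈ Finset.range L, Fintype.card V * (firstCollision π t l s).card := Finset.mul_sum ..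
    _ ≤ (Finset.range L).card • ((fpfInvolutions V).card * (6 * L)) :=
      Finset.sum_le_card_nsmul _ _ _ hl
    _ = _ := by rw [Finset.card_range, smul_eq_mul]; ring

end Switching

/-! ### Closing a path into a cycle of size m -/

section ShortCycles

variable {V : Type*} [Fintype V] [DecidableEq V]

/-- Follow the `a`-edge, then the `π`-edge. -/
def abMap (π a : Perm V) (v : V) : V := π (a v)

lemma walk_const (π a : Perm V) (i : ℕ) (s : V) : walk a (fun _ => π) i s = (abMap π a)^[i] s := by
  induction i with
  | zero => rfl
  | succ i ih => rw [walk_succ, ih, Function.iterate_succ_apply']; rfl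

/-- The matchings for which there are no `ab`-cycles of size between `2` and `m`. -/
noncomputable def noShort (π : Perm V) (m : ℕ) : Finset (Perm V) :=
  open Classical in (fpfInvolutions V).filter fun a =>
    ∀ v k, 2 ≤ k → k ≤ m → Function.minimalPeriod (abMap π a) v ≠ k

lemma mem_noShort {π a : Perm V} {m : ℕ} : a ∈ noShort π m ↔ a ∈ fpfInvolutions V ∧
    ∀ v k, 2 ≤ k → k ≤ m → Function.minimalPeriod (abMap π a) v ≠ k := by
  simp [noShort]

lemma noShort_one (π : Perm V) : noShort π 1 = fpfInvolutions V := by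
  ext a
  rw [mem_noShort]
  exact ⟨fun h => h.1, fun h => ⟨h, fun v k h1 h2 => by omega⟩⟩

lemma noShort_anti (π : Perm V) {m m' : ℕ} (h : m ≤ m') : noShort π m' ⊆ noShort π m := by
  intro a ha
  rw [mem_noShort] at *
  exact ⟨ha.1, fun v k h1 h2 => ha.2 v k h1 (h2.trans h)⟩

/-- The conditions under which closing up the path of length `m` from `x` by a switch creates a
cycle of size `m` and no other short cycle. -/
structure CanClose (π a : Perm V) (m : ℕ) (x : V) : Prop where
  path : ∀ j < m, (abMap π a)^[j] x ≠ π⁻¹ x ∧ (abMap π a)^[j] x ≠ a (π⁻¹ x) ∧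
    (abMap π a)^[j] x ≠ a ((abMap π a)^[m - 1] x)
  inj : ∀ i j, i < j → j < m → (abMap π a)^[i] x ≠ (abMap π a)^[j] x
  ends : ∀ s, (s = π (a ((abMap π a)^[m - 1] x)) ∨ s = π ((abMap π a)^[m - 1] x) ∨
      s = π (a (π⁻¹ x))) → ∀ i < m, (abMap π a)^[i] s ≠ (abMap π a)^[m - 1] x ∧
    (abMap π a)^[i] s ≠ π⁻¹ x ∧ (abMap π a)^[i] s ≠ a (π⁻¹ x) ∧
    (abMap π a)^[i] s ≠ a ((abMap π a)^[m - 1] x)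

/-- The matching obtained from `a` by closing up the path of length `m` from `x`. -/
def closeUp (π a : Perm V) (m : ℕ) (x : V) : Perm V :=
  switch a ((abMap π a)^[m - 1] x) (π⁻¹ x)

namespace CanClose

variable {π a : Perm V} {m : ℕ} {x : V}

lemma ne (h : CanClose π a m x) (hm : 2 ≤ m) : (abMap π a)^[m - 1] x ≠ π⁻¹ x :=
  (h.path (m - 1) (by omega)).1

lemma abMap_of_ne (ha : a ∈ fpfInvolutions V) {v : V}
    (h1 : v ≠ (abMap π a)^[m - 1] x) (h2 : v ≠ π⁻¹ x) (h3 : v ≠ a (π⁻¹ x))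
    (h4 : v ≠ a ((abMap π a)^[m - 1] x)) :
    abMap π (closeUp π a m x) v = abMap π a v := by
  unfold abMap closeUp
  rw [switch_apply_of_ne ha h1 h2 h4 h3]

lemma iterate_eq (h : CanClose π a m x) (ha : a ∈ fpfInvolutions V) {j : ℕ} (hj : j < m) :
    (abMap π (closeUp π a m x))^[j] x = (abMap π a)^[j] x := by
  induction j with
  | zero => rfl
  | succ j ih =>
    obtain ⟨h1, h2, h3⟩ := h.path j (by omega)
    rw [Function.iterate_succ_apply', Function.iterate_succ_apply', ih (by omega)]
    exact abMap_of_ne ha (h.inj _ _ (by omega) (by omega)) h1 h2 h3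

lemma iterate_self (h : CanClose π a m x) (ha : a ∈ fpfInvolutions V) (hm : 2 ≤ m) :
    (abMap π (closeUp π a m x))^[m] x = x := by
  obtain ⟨k, rfl⟩ : ∃ k, m = k + 1 := ⟨m - 1, by omega⟩
  rw [Function.iterate_succ_apply', h.iterate_eq ha (Nat.lt_succ_self k)]
  have := switch_apply_left ha (h.ne hm)
  simp only [Nat.add_sub_cancel] at this
  rw [abMap, closeUp, Nat.add_sub_cancel, this]
  simp

lemma minimalPeriod_eq (h : CanClose π a m x) (ha : a ∈ fpfInvolutions V) (hm : 2 ≤ m) :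
    Function.minimalPeriod (abMap π (closeUp π a m x)) x = m := by
  have hp : Function.IsPeriodicPt (abMap π (closeUp π a m x)) m x := h.iterate_self ha hm
  refine le_antisymm (hp.minimalPeriod_le (by omega)) ?_
  by_contra! hlt
  have h0 := hp.minimalPeriod_pos (by omega)
  have h1 := h.inj 0 _ h0 hlt
  rw [← h.iterate_eq ha hlt, Function.iterate_minimalPeriod] at h1
  exact h1 rfl

/-- Besides the endpoint of the path, the switch changes the edges at three vertices. Their new
successors are exactly the starting points in `ends`, and from there the old path meets no changed
vertex for `m` steps, so none of the three lies on a cycle of size at most `m`. -/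
lemma iterate_ne (h : CanClose π a m x) (ha : a ∈ fpfInvolutions V) (hm : 2 ≤ m) {c : V}
    (hc : c = π⁻¹ x ∨ c = a (π⁻¹ x) ∨ c = a ((abMap π a)^[m - 1] x)) {k : ℕ} (hk : 0 < k)
    (hkm : k ≤ m) : (abMap π (closeUp π a m x))^[k] c ≠ c := by
  have hs : abMap π (closeUp π a m x) c = π (a ((abMap π a)^[m - 1] x)) ∨
      abMap π (closeUp π a m x) c = π ((abMap π a)^[m - 1] x) ∨
      abMap π (closeUp π a m x) c = π (a (π⁻¹ x)) := by
    unfold abMap closeUp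
    rcases hc with rfl | rfl | rfl
    · rw [switch_apply_right ha (h.ne hm)]; exact Or.inr (Or.inl rfl)
    · rw [switch_apply_partner' ha (h.ne hm)]; exact Or.inl rfl
    · rw [switch_apply_partner ha (h.ne hm)]; exact Or.inr (Or.inr rfl)
  have he := h.ends _ hs
  have key : ∀ i < m, (abMap π (closeUp π a m x))^[i] (abMap π (closeUp π a m x) c) =
      (abMap π a)^[i] (abMap π (closeUp π a m x) c) := by
    intro i hi
    induction i with
    | zero => rfl
    | succ i ih =>
      obtain ⟨h1, h2, h3, h4⟩ := he i (by omega)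
      rw [Function.iterate_succ_apply', ih (by omega), Function.iterate_succ_apply']
      exact abMap_of_ne ha h1 h2 h3 h4
  obtain ⟨i, rfl⟩ : ∃ i, k = i + 1 := ⟨k - 1, by omega⟩
  rw [Function.iterate_succ_apply, key i (by omega)]
  obtain ⟨-, h2, h3, h4⟩ := he i (by omega)
  rcases hc with hc | hc | hc
  · exact hc ▸ h2
  · exact hc ▸ h3
  · rw [← hc] at h4; exact h4

/-- A short cycle of the new matching through the path's end is the cycle of `x`. Any other avoids
all four changed vertices, hence was already a cycle of `a`, contrary to `noShort`. -/
lemma exists_iterate (h : CanClose π a m x) (ha : a ∈ noShort π m) (hm : 2 ≤ m) {v : V}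
    (h2 : 2 ≤ Function.minimalPeriod (abMap π (closeUp π a m x)) v)
    (hk : Function.minimalPeriod (abMap π (closeUp π a m x)) v ≤ m) :
    ∃ N, v = (abMap π (closeUp π a m x))^[N] x := by
  have haI := (mem_noShort.1 ha).1
  set g := abMap π (closeUp π a m x) with hg
  set k := Function.minimalPeriod g v with hkdef
  have hper : Function.IsPeriodicPt g k v := Function.isPeriodicPt_minimalPeriod g v
  have hperj : ∀ j, g^[k] (g^[j] v) = g^[j] v := fun j => hper.apply_iterate j
  by_cases hp : ∃ j, g^[j] v = (abMap π a)^[m - 1] x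
  · obtain ⟨j, hj⟩ := hp
    have h1 : g^[j + 1] v = x := by
      have h3 := h.iterate_self haI hm
      rw [← hg] at h3
      rw [Function.iterate_succ_apply', hj, ← h.iterate_eq haI (by omega : m - 1 < m), ← hg,
        ← Function.iterate_succ_apply' g, Nat.succ_eq_add_one, Nat.sub_add_cancel (by omega)]
      exact h3
    -- From `v`, `j + 1` steps lead to `x` and `(j + 1) * k` steps lead back to `v`; this is the
    -- difference.
    refine ⟨(j + 1) * (k - 1), ?_⟩
    rw [← h1, ← Function.iterate_add_apply]
    have h4 : (j + 1) * (k - 1) + (j + 1) = (j + 1) * k := by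
      obtain ⟨k', hk'⟩ : ∃ k', k = k' + 1 := ⟨k - 1, by omega⟩
      rw [hk', Nat.add_sub_cancel]; ring
    rw [h4]
    exact (hper.const_mul (j + 1)).symm
  · push Not at hp
    exfalso
    have hcut : ∀ j, ∀ c, (c = π⁻¹ x ∨ c = a (π⁻¹ x) ∨ c = a ((abMap π a)^[m - 1] x)) →
        g^[j] v ≠ c := by
      rintro j c hc rfl
      exact h.iterate_ne haI hm hc (by omega) hk (hperj j)
    have heq : ∀ j, (abMap π a)^[j] v = g^[j] v := by
      intro j
      induction j with
      | zero => rfl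
      | succ j ih =>
        rw [Function.iterate_succ_apply', ih, Function.iterate_succ_apply']
        exact (abMap_of_ne haI (hp j) (hcut j _ (Or.inl rfl)) (hcut j _ (Or.inr (Or.inl rfl)))
          (hcut j _ (Or.inr (Or.inr rfl)))).symm
    refine (mem_noShort.1 ha).2 v k h2 hk ?_
    rw [hkdef, Function.minimalPeriod_eq_minimalPeriod_iff]
    intro j
    simp only [Function.IsPeriodicPt, Function.IsFixedPt, heq]

lemma closeUp_mem (h : CanClose π a m x) (ha : a ∈ noShort π m) (hm : 2 ≤ m) :
    closeUp π a m x ∈ noShort π (m - 1) \ noShort π m := by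
  have haI := (mem_noShort.1 ha).1
  have hx := h.minimalPeriod_eq haI hm
  have hI : closeUp π a m x ∈ fpfInvolutions V := switch_mem haI _ _
  rw [Finset.mem_sdiff]
  constructor
  · rw [mem_noShort]
    refine ⟨hI, fun v k h2 hk hv => ?_⟩
    obtain ⟨N, rfl⟩ := h.exists_iterate ha hm (hv.symm ▸ h2) (by omega)
    rw [Function.minimalPeriod_apply_iterate, hx] at hv
    · omega
    · rw [← Function.minimalPeriod_pos_iff_mem_periodicPts, hx]; omega
  · intro hn
    exact (mem_noShort.1 hn).2 x m hm le_rfl hx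

lemma card_minimalPeriod_le (h : CanClose π a m x) (ha : a ∈ noShort π m) (hm : 2 ≤ m) :
    (Finset.univ.filter fun v =>
      Function.minimalPeriod (abMap π (closeUp π a m x)) v = m).card ≤ m := by
  have hx := h.minimalPeriod_eq (mem_noShort.1 ha).1 hm
  have hsub : (Finset.univ.filter fun v =>
      Function.minimalPeriod (abMap π (closeUp π a m x)) v = m) ⊆
      (Finset.range m).image fun j => (abMap π (closeUp π a m x))^[j] x := by
    intro v hv
    have hv : Function.minimalPeriod (abMap π (closeUp π a m x)) v = m := by simpa using hv
    obtain ⟨N, hN⟩ := h.exists_iterate ha hm (by omega) hv.le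
    refine Finset.mem_image.2 ⟨N % m, Finset.mem_range.2 (Nat.mod_lt _ (by omega)), ?_⟩
    have h1 := Function.iterate_mod_minimalPeriod_eq (f := abMap π (closeUp π a m x)) (x := x)
      (n := N)
    rw [hx] at h1
    exact h1.trans hN.symm
  exact (Finset.card_le_card hsub).trans (Finset.card_image_le.trans (Finset.card_range m).le)

end CanClose

/-! ### Walks without repeated triangles permit closing -/

/-- The turns along a path of length `m` in reverse, followed by a path. -/
def backForth (π : Perm V) (m : ℕ) (i : ℕ) : Perm V := if i < m then π⁻¹ else π

/-- The turns of a path that leaves an `ab`-path at step `m` by the other side. -/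
def sideStep (π : Perm V) (m : ℕ) (i : ℕ) : Perm V := if i + 1 = m then π⁻¹ else π

lemma isTurn_backForth (π : Perm V) (m : ℕ) : IsTurn π (backForth π m) := fun i => by
  unfold backForth; split_ifs <;> simp

lemma isTurn_sideStep (π : Perm V) (m : ℕ) : IsTurn π (sideStep π m) := fun i => by
  unfold sideStep; split_ifs <;> simp

lemma isTurn_const (π : Perm V) : IsTurn π (fun _ => π) := fun _ => Or.inl rfl

/-- Write `y = π⁻¹ x` and let `p` be the path's end. The first walk contains, in one piece, the
reverse of the `ab`-path from `π (a y)`, the vertices `a y` and `x`, the path to `p` and its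
continuation beyond `a p`. The second enters the triangle of `p` but leaves by `π p`, separating
that path from `y` and `a y`. The third starts at `a p` and separates the path from `π p` from `a
p`. -/
lemma canClose_of_spread {π a : Perm V} (hπ : π ^ 3 = 1) (hf : ∀ v, π v ≠ v)
    (ha : a ∈ fpfInvolutions V) {m : ℕ} (hm : 2 ≤ m) {x : V}
    (hA : Spread π a (backForth π m) (3 * m + 1) ((walk a (backForth π m) (m + 1))⁻¹ x))
    (hB : Spread π a (sideStep π m) (2 * m) (a (π⁻¹ x)))
    (hC : Spread π a (fun _ => π) m (a (walk a (fun _ => π) (m - 1) x))) :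
    CanClose π a m x := by
  have hinv : ∀ v, π⁻¹ v ≠ v := fun v h => hf v (by rw [Perm.inv_eq_iff_eq] at h; exact h.symm)
  have hself := self_mem_tri π
  obtain ⟨p, hp⟩ : ∃ p, (abMap π a)^[m - 1] x = p := ⟨_, rfl⟩
  obtain ⟨y, hy⟩ : ∃ y, π⁻¹ x = y := ⟨_, rfl⟩
  -- the walk through `a y`, `x` and `p`
  obtain ⟨u, hu, u1, hAne⟩ : ∃ u : ℕ → V, (∀ i, u (i + 1) = backForth π m i (a (u i))) ∧
      u (m + 1) = x ∧ ∀ {i j : ℕ}, i ≠ j → i ≤ 3 * m + 1 → j ≤ 3 * m + 1 → ∀ {v v' : V},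
        v ∈ tri π (u i) → v' ∈ tri π (u j) → v ≠ v' :=
    ⟨fun i => walk a (backForth π m) i ((walk a (backForth π m) (m + 1))⁻¹ x),
      fun i => rfl, by simp, fun h hi hj _ _ hv hv' => hA.ne hπ h hi hj hv hv'⟩
  -- the walk that leaves the path from `x` to `p` in the triangle of `p`
  obtain ⟨w, hw0, hw, hBne⟩ : ∃ w : ℕ → V, w 0 = a y ∧
      (∀ i, w (i + 1) = sideStep π m i (a (w i))) ∧
      ∀ {i j : ℕ}, i ≠ j → i ≤ 2 * m → j ≤ 2 * m → ∀ {v v' : V},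
        v ∈ tri π (w i) → v' ∈ tri π (w j) → v ≠ v' :=
    ⟨fun i => walk a (sideStep π m) i (a y), rfl, fun i => rfl,
      fun h hi hj _ _ hv hv' => (hy ▸ hB).ne hπ h hi hj hv hv'⟩
  -- The first step from `a p` crosses back to `p` and turns to `π p`.
  have hC' : ∀ i < m, (abMap π a)^[i] (π p) ≠ a p := by
    intro i hi
    have h1 := hC.ne hπ (i := i + 1) (j := 0) (by omega) (by omega) (by omega)
      (hself _) (hself _)
    rw [walk_const, walk_const, walk_const, Function.iterate_succ_apply, hp] at h1
    simpa [abMap, apply_apply_of_mem ha] using h1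
  clear hA hB hC
  have um : u m = a y := by
    have h := hu m
    rw [u1, backForth, if_neg (lt_irrefl m)] at h
    rw [← hy, h]
    simp [apply_apply_of_mem ha]
  have uf : ∀ j, (abMap π a)^[j] x = u (m + 1 + j) := by
    intro j
    induction j with
    | zero => exact u1.symm
    | succ j ih =>
      rw [Function.iterate_succ_apply', ih, ← add_assoc, hu, backForth, if_neg (by omega)]
      rfl
  have ub : ∀ i ≤ m, (abMap π a)^[i] (π (a y)) = π (u (m - i)) := by
    intro i hi
    induction i with
    | zero => rw [← um]; rfl
    | succ i ih =>
      rw [Function.iterate_succ_apply', ih (by omega)]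
      obtain ⟨j, hj⟩ : ∃ j, m - i = j + 1 := ⟨m - i - 1, by omega⟩
      rw [hj, show m - (i + 1) = j by omega, hu, backForth, if_pos (by omega)]
      simp [abMap, apply_apply_of_mem ha]
  have up : p = u (2 * m) := by rw [← hp, uf]; congr 1; omega
  have mp : p ∈ tri π (u (2 * m)) := up ▸ hself p
  have mz : a p ∈ tri π (u (2 * m + 1)) := by
    rw [up, hu]
    exact mem_tri_symm.1 ((isTurn_backForth π m).mem_tri _ _)
  have my : y ∈ tri π (u (m + 1)) := by rw [u1, ← hy]; simp [mem_tri]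
  have mw : a y ∈ tri π (u m) := by rw [um]; exact hself _
  have mf : ∀ j, (abMap π a)^[j] x ∈ tri π (u (m + 1 + j)) := fun j => by
    rw [uf]; exact hself _
  have t1 : ∀ j, j + 1 < m → w (j + 1) = (abMap π a)^[j] x := by
    intro j hj
    induction j with
    | zero =>
      rw [hw, hw0, apply_apply_of_mem ha, sideStep, if_neg (by omega), ← hy]
      simp
    | succ j ih =>
      rw [hw, ih (by omega), Function.iterate_succ_apply', sideStep, if_neg (by omega)]
      rfl
  have tB : ∀ i, w (m + i) = (abMap π a)^[i] (π p) := by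
    intro i
    induction i with
    | zero =>
      obtain ⟨k, rfl⟩ : ∃ k, m = k + 2 := ⟨m - 2, by omega⟩
      rw [add_zero, hw, t1 k (by omega), sideStep, if_pos rfl, ← hp,
        show k + 2 - 1 = k + 1 by omega, Function.iterate_succ_apply', abMap,
        Function.iterate_zero, id_eq, apply_apply_eq_inv hπ]
    | succ i ih =>
      rw [← add_assoc, hw, ih, Function.iterate_succ_apply', sideStep, if_neg (by omega)]
      rfl
  have myB : y ∈ tri π (w 1) := by
    rw [hw, hw0, apply_apply_of_mem ha]
    exact mem_tri_symm.1 ((isTurn_sideStep π m).mem_tri _ _)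
  refine ⟨fun j hj => ⟨?_, ?_, ?_⟩, fun i j hij hj => ?_, ?_⟩
  · rw [hy]
    rcases Nat.eq_zero_or_pos j with rfl | hj0
    · exact hy ▸ (hinv x).symm
    · exact hAne (by omega) (by omega) (by omega) (mf j) my
  · rw [hy]
    exact hAne (by omega) (by omega) (by omega) (mf j) mw
  · rw [hp]
    exact hAne (by omega) (by omega) (by omega) (mf j) mz
  · exact hAne (by omega) (by omega) (by omega) (mf i) (mf j)
  · rw [hp, hy]
    rintro r (rfl | rfl | rfl) i hi
    · have e : (abMap π a)^[i] (π (a p)) ∈ tri π (u (2 * m + 1 + i)) := by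
        have h1 : π (a p) = (abMap π a)^[m] x := by
          obtain ⟨k, rfl⟩ : ∃ k, m = k + 1 := ⟨m - 1, by omega⟩
          rw [Function.iterate_succ_apply', ← hp]; rfl
        rw [h1, ← Function.iterate_add_apply, uf,
          show m + 1 + (i + m) = 2 * m + 1 + i by omega]
        exact hself _
      refine ⟨hAne (by omega) (by omega) (by omega) e mp,
        hAne (by omega) (by omega) (by omega) e my,
        hAne (by omega) (by omega) (by omega) e mw, ?_⟩
      rcases Nat.eq_zero_or_pos i with rfl | hi0
      · exact hf _
      · exact hAne (by omega) (by omega) (by omega) e mz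
    · have e : (abMap π a)^[i] (π p) ∈ tri π (w (m + i)) := by rw [tB i]; exact hself _
      refine ⟨?_, hBne (by omega) (by omega) (by omega) e myB,
        hBne (i := m + i) (j := 0) (by omega) (by omega) (by omega) e (hw0 ▸ hself _), hC' i hi⟩
      rcases Nat.eq_zero_or_pos i with rfl | hi0
      · exact hf _
      · refine hBne (i := m + i) (j := m + 0) (by omega) (by omega) (by omega) e ?_
        rw [tB 0]
        simp [mem_tri]
    · have e : (abMap π a)^[i] (π (a y)) ∈ tri π (u (m - i)) := by
        rw [ub i hi.le]; simp [mem_tri]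
      refine ⟨hAne (by omega) (by omega) (by omega) e mp,
        hAne (by omega) (by omega) (by omega) e my, ?_,
        hAne (by omega) (by omega) (by omega) e mz⟩
      rcases Nat.eq_zero_or_pos i with rfl | hi0
      · exact hf _
      · exact hAne (by omega) (by omega) (by omega) e mw

-- For each matching `e a` is a bijection, so a uniform `x` gives a uniform starting vertex, even
-- though the start depends on the matching.
open Classical in
lemma card_pairs_not_spread_le {π : Perm V} (hπ : π ^ 3 = 1) (hf : ∀ v, π v ≠ v)
    {t : ℕ → Perm V} (ht : IsTurn π t) {L : ℕ} (hL : 2 ≤ L) (e : Perm V → Perm V) :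
    ((fpfInvolutions V ×ˢ Finset.univ).filter fun x => ¬ Spread π x.1 t L (e x.1 x.2)).card ≤
      (fpfInvolutions V).card * (6 * L ^ 2) := by
  rcases isEmpty_or_nonempty V with hV | hV
  · simp
  refine Nat.le_of_mul_le_mul_left ?_ (Fintype.card_pos (α := V))
  rw [Finset.card_filter, Finset.sum_product]
  have h1 : ∀ a : Perm V, ∑ x : V, (if ¬ Spread π a t L (e a x) then 1 else 0) =
      ∑ s : V, (if ¬ Spread π a t L s then 1 else 0) := fun a =>
    Equiv.sum_comp (e a) fun s => if ¬ Spread π a t L s then 1 else 0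
  simp only [h1]
  rw [Finset.sum_comm, Finset.mul_sum]
  simp only [← Finset.card_filter]
  have h2 := Finset.sum_le_card_nsmul (Finset.univ : Finset V)
    (fun s => Fintype.card V * ((fpfInvolutions V).filter fun a => ¬ Spread π a t L s).card)
    _ fun s _ => card_not_spread_le hπ hf ht hL s
  rwa [Finset.card_univ, smul_eq_mul] at h2

/-! ### The switching inequality and its telescoping -/

open Classical in
/-- The pairs of a matching without short cycles and the start of a path that can be closed up. -/
noncomputable def closable (π : Perm V) (m : ℕ) : Finset (Perm V × V) :=
  (noShort π m ×ˢ (Finset.univ : Finset V)).filter fun x => CanClose π x.1 m x.2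

lemma mem_closable {π : Perm V} {m : ℕ} {x : Perm V × V} :
    x ∈ closable π m ↔ x.1 ∈ noShort π m ∧ CanClose π x.1 m x.2 := by
  simp [closable]

lemma card_mul_card_noShort_le {π : Perm V} (hπ : π ^ 3 = 1) (hf : ∀ v, π v ≠ v) {m : ℕ}
    (hm : 2 ≤ m) : Fintype.card V * (noShort π m).card ≤
      104 * m ^ 2 * (fpfInvolutions V).card + (closable π m).card := by
  classical
  have key : ∀ {t : ℕ → Perm V} {L : ℕ} (_ : IsTurn π t) (_ : 2 ≤ L) (e : Perm V → Perm V),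
      ∃ B : Finset (Perm V × V), B.card ≤ (fpfInvolutions V).card * (6 * L ^ 2) ∧
        ∀ x : Perm V × V, x.1 ∈ fpfInvolutions V → x ∉ B → Spread π x.1 t L (e x.1 x.2) := by
    intro t L ht hL e
    refine ⟨_, card_pairs_not_spread_le hπ hf ht hL e, fun x hx hxB => ?_⟩
    by_contra hn
    exact hxB (Finset.mem_filter.2 ⟨by simpa using hx, hn⟩)
  obtain ⟨B₁, h1, k1⟩ := key (isTurn_backForth π m) (by omega : 2 ≤ 3 * m + 1)
    fun a => (walk a (backForth π m) (m + 1))⁻¹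
  obtain ⟨B₂, h2, k2⟩ := key (isTurn_sideStep π m) (by omega : 2 ≤ 2 * m) fun a => a * π⁻¹
  obtain ⟨B₃, h3, k3⟩ := key (isTurn_const π) hm fun a => a * walk a (fun _ => π) (m - 1)
  have hcover : noShort π m ×ˢ (Finset.univ : Finset V) ⊆ closable π m ∪ (B₁ ∪ (B₂ ∪ B₃)) := by
    intro x hx
    have ha : x.1 ∈ noShort π m := (Finset.mem_product.1 hx).1
    have haI := (mem_noShort.1 ha).1
    by_contra hn
    simp only [Finset.mem_union, not_or] at hn
    obtain ⟨hnS, hn1, hn2, hn3⟩ := hn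
    exact hnS (mem_closable.2
      ⟨ha, canClose_of_spread hπ hf haI hm (k1 x haI hn1) (k2 x haI hn2) (k3 x haI hn3)⟩)
  have h4 := Finset.card_le_card hcover
  have h5 := Finset.card_union_le (closable π m) (B₁ ∪ (B₂ ∪ B₃))
  have h6 := Finset.card_union_le B₁ (B₂ ∪ B₃)
  have h7 := Finset.card_union_le B₂ B₃
  rw [Finset.card_product, Finset.card_univ, mul_comm] at h4
  have h8 : (fpfInvolutions V).card * (6 * (3 * m + 1) ^ 2) +
      ((fpfInvolutions V).card * (6 * (2 * m) ^ 2) + (fpfInvolutions V).card * (6 * m ^ 2)) ≤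
      104 * m ^ 2 * (fpfInvolutions V).card := by
    -- The sum is 84m² + 36m + 6, and 36m + 6 ≤ 20m² once 2 ≤ `m`.
    have : 6 * (3 * m + 1) ^ 2 + (6 * (2 * m) ^ 2 + 6 * m ^ 2) ≤ 104 * m ^ 2 := by nlinarith
    calc _ = (6 * (3 * m + 1) ^ 2 + (6 * (2 * m) ^ 2 + 6 * m ^ 2)) *
          (fpfInvolutions V).card := by ring
      _ ≤ _ := by gcongr
  calc _ ≤ (closable π m).card + (B₁.card + (B₂.card + B₃.card)) := by linarith
    _ ≤ (closable π m).card + 104 * m ^ 2 * (fpfInvolutions V).card :=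
      Nat.add_le_add_left ((Nat.add_le_add h1 (Nat.add_le_add h2 h3)).trans h8) _
    _ = _ := add_comm _ _

/-- Comparing the matchings without cycles of size `2, …, m` to those whose only cycle with such a
size is a single cycle of size `m`. -/
lemma card_noShort_step {π : Perm V} (hπ : π ^ 3 = 1) (hf : ∀ v, π v ≠ v) {m : ℕ} (hm : 2 ≤ m) :
    Fintype.card V * (noShort π m).card ≤ 104 * m ^ 2 * (fpfInvolutions V).card +
      Fintype.card V * m * ((noShort π (m - 1)).card - (noShort π m).card) := by
  classical
  let T := ((noShort π (m - 1) \ noShort π m).filter fun a =>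
    (Finset.univ.filter fun v => Function.minimalPeriod (abMap π a) v = m).card ≤ m).sigma
      fun a => (Finset.univ.filter fun v => Function.minimalPeriod (abMap π a) v = m) ×ˢ
        (Finset.univ : Finset V)
  have hT : T.card ≤ Fintype.card V * m * ((noShort π (m - 1)).card - (noShort π m).card) := by
    rw [Finset.card_sigma, ← Finset.card_sdiff_of_subset (noShort_anti π (Nat.sub_le m 1))]
    refine (Finset.sum_le_card_nsmul _ _ (m * Fintype.card V) fun a ha => ?_).trans ?_
    · rw [Finset.card_product, Finset.card_univ]
      exact Nat.mul_le_mul_right _ (Finset.mem_filter.1 ha).2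
    · rw [smul_eq_mul, mul_comm m, mul_comm]
      exact Nat.mul_le_mul_left _ (Finset.card_filter_le _ _)
  have hST : (closable π m).card ≤ T.card := by
    refine Finset.card_le_card_of_injOn
      -- The path's end is recovered as the predecessor of `x` on the new cycle; with its old
      -- partner, `switch_switch` then returns the matching.
      (fun x => ⟨closeUp π x.1 m x.2, x.2, x.1 ((abMap π x.1)^[m - 1] x.2)⟩) ?_ ?_
    · rintro ⟨a, x⟩ hx
      have hx : a ∈ noShort π m ∧ CanClose π a m x := mem_closable.1 hx
      obtain ⟨ha, h⟩ := hx
      have h1 := h.closeUp_mem ha hm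
      rw [Finset.mem_coe, Finset.mem_sigma, Finset.mem_filter]
      refine ⟨⟨h1, h.card_minimalPeriod_le ha hm⟩, ?_⟩
      simp [h.minimalPeriod_eq (mem_noShort.1 ha).1 hm]
    · rintro ⟨a, x⟩ hx ⟨b, x'⟩ hy hxy
      have hx : a ∈ noShort π m ∧ CanClose π a m x := mem_closable.1 hx
      have hy : b ∈ noShort π m ∧ CanClose π b m x' := mem_closable.1 hy
      simp only [Sigma.mk.injEq] at hxy
      obtain ⟨e1, e2⟩ := hxy
      have e3 := eq_of_heq e2
      simp only [Prod.mk.injEq] at e3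
      obtain ⟨rfl, e4⟩ := e3
      have haI := (mem_noShort.1 hx.1).1
      have hbI := (mem_noShort.1 hy.1).1
      have e5 : (abMap π a)^[m - 1] x = (abMap π b)^[m - 1] x := by
        rw [← hx.2.iterate_eq haI (by omega : m - 1 < m),
          ← hy.2.iterate_eq hbI (by omega : m - 1 < m), e1]
      have e6 : a = b := by
        rw [← switch_switch haI (hx.2.ne hm), ← switch_switch hbI (hy.2.ne hm), e4]
        unfold closeUp at e1
        rw [e1, e5]
      rw [e6]
  exact (card_mul_card_noShort_le hπ hf hm).trans (Nat.add_le_add_left (hST.trans hT) _)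

/-- A random matching has no cycle of size between `2` and `M` with probability `O(1 / M)`. -/
lemma card_noShort_le {π : Perm V} (hπ : π ^ 3 = 1) (hf : ∀ v, π v ≠ v) {M : ℕ} (hM : 1 ≤ M)
    (hMV : M ^ 3 ≤ Fintype.card V) :
    (M + 1) * (noShort π M).card ≤ 106 * (fpfInvolutions V).card := by
  -- Each step adds an error 104(m+1)²N, bounded uniformly by 104M²N.
  have key : ∀ m, 1 ≤ m → m ≤ M → Fintype.card V * ((m + 1) * (noShort π m).card) ≤
      (2 * Fintype.card V + 104 * (m * M ^ 2)) * (fpfInvolutions V).card := by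
    intro m hm
    induction m, hm using Nat.le_induction with
    | base => intro _; rw [noShort_one]; nlinarith [Nat.zero_le (M ^ 2 * (fpfInvolutions V).card)]
    | succ m hm ih =>
      intro hmM
      have h1 := ih (by omega)
      have h2 := card_noShort_step hπ hf (m := m + 1) (by omega)
      have h3 := Finset.card_le_card (noShort_anti π (Nat.le_succ m))
      rw [Nat.add_sub_cancel] at h2
      obtain ⟨d, hd⟩ := Nat.exists_eq_add_of_le h3
      rw [hd] at h1 h2
      rw [Nat.succ_eq_add_one, Nat.add_sub_cancel_left] at h2
      have h4 : (m + 1) ^ 2 * (fpfInvolutions V).card ≤ M ^ 2 * (fpfInvolutions V).card := by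
        gcongr
      nlinarith
  have h := key M hM le_rfl
  have h0 : 0 < Fintype.card V := lt_of_lt_of_le (by positivity) hMV
  refine Nat.le_of_mul_le_mul_left (h.trans ?_) h0
  have : M * M ^ 2 ≤ Fintype.card V := by rw [← pow_succ']; exact hMV
  calc _ ≤ (2 * Fintype.card V + 104 * Fintype.card V) * (fpfInvolutions V).card := by gcongr
    _ = _ := by ring

end ShortCycles

/-! ### Counting roots of the identity and disconnected pairs -/

section Counting

variable {V : Type*} [Fintype V] [DecidableEq V]

lemma cycleType_of_mem_fpfRoots {p : ℕ} (hp : p.Prime) {σ : Perm V} (h : σ ∈ fpfRoots p V) :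
    ∃ k, Fintype.card V = p * k ∧ σ.cycleType = Multiset.replicate k p := by
  have := Fact.mk hp
  obtain ⟨h1, h2⟩ := mem_fpfRoots.1 h
  have h3 := Perm.cycleType_of_pow_prime_eq_one h1
  refine ⟨_, ?_, h3⟩
  have h4 : σ.support = Finset.univ := by ext v; simp [h2]
  have h5 := σ.sum_cycleType
  rw [h4, Finset.card_univ, h3, Multiset.sum_replicate, smul_eq_mul, mul_comm] at h5
  exact h5.symm

lemma dvd_card_of_mem_fpfRoots {p : ℕ} (hp : p.Prime) {σ : Perm V} (h : σ ∈ fpfRoots p V) :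
    p ∣ Fintype.card V := by
  obtain ⟨k, hk, -⟩ := cycleType_of_mem_fpfRoots hp h
  exact ⟨k, hk⟩

lemma mem_fpfRoots_iff_cycleType {p k : ℕ} (hp : p.Prime) (hV : Fintype.card V = p * k)
    {σ : Perm V} : σ ∈ fpfRoots p V ↔ σ.cycleType = Multiset.replicate k p := by
  have := Fact.mk hp
  constructor
  · intro h
    obtain ⟨k', hk', h⟩ := cycleType_of_mem_fpfRoots hp h
    rw [h, Nat.eq_of_mul_eq_mul_left hp.pos (hk'.symm.trans hV)]
  · intro h
    rw [mem_fpfRoots, Perm.pow_prime_eq_one_iff]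
    refine ⟨fun c hc => Multiset.eq_of_mem_replicate (h ▸ hc), fun v => ?_⟩
    have h5 := σ.sum_cycleType
    rw [h, Multiset.sum_replicate, smul_eq_mul, mul_comm, ← hV] at h5
    have h6 := (Finset.card_eq_iff_eq_univ _).1 h5.symm
    exact Perm.mem_support.1 (h6 ▸ Finset.mem_univ v)

open Nat in
lemma card_fpfRoots_mul {p k : ℕ} (hp : p.Prime) (hV : Fintype.card V = p * k) :
    (fpfRoots p V).card * (p ^ k * k !) = (p * k)! := by
  have h1 : fpfRoots p V = Finset.univ.filter fun σ => σ.cycleType = Multiset.replicate k p := by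
    ext σ
    rw [mem_fpfRoots_iff_cycleType hp hV]
    simp
  have h2 := Perm.card_of_cycleType_mul_eq V (Multiset.replicate k p)
  have h3 : ∏ n ∈ (Multiset.replicate k p).toFinset, ((Multiset.replicate k p).count n)! = k ! := by
    rcases Nat.eq_zero_or_pos k with rfl | hk
    · simp
    · rw [Multiset.toFinset_replicate, if_neg hk.ne']
      simp
  rw [h3, Multiset.prod_replicate, Multiset.sum_replicate, smul_eq_mul, hV, mul_comm k p,
    Nat.sub_self, if_pos ⟨le_rfl, fun a ha => (Multiset.eq_of_mem_replicate ha).symm ▸ hp.two_le⟩,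
    Nat.factorial_zero, one_mul] at h2
  rw [h1]
  exact h2

/-- The fixpoint-free `p`-th roots of the identity that preserve `S`. -/
def fpfRootsOn (p : ℕ) (S : Finset V) : Finset (Perm V) :=
  (fpfRoots p V).filter fun σ => ∀ v, σ v ∈ S ↔ v ∈ S

lemma mem_fpfRootsOn {p : ℕ} {S : Finset V} {σ : Perm V} :
    σ ∈ fpfRootsOn p S ↔ σ ∈ fpfRoots p V ∧ ∀ v, σ v ∈ S ↔ v ∈ S := by
  simp [fpfRootsOn]

lemma subtypePerm_mem_fpfRoots {p : ℕ} {P : V → Prop} [Fintype {v // P v}] {σ : Perm V}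
    (hσ : σ ∈ fpfRoots p V) (h : ∀ v, P (σ v) ↔ P v) :
    σ.subtypePerm h ∈ fpfRoots p {v // P v} := by
  rw [mem_fpfRoots] at *
  refine ⟨?_, fun v hv => hσ.2 v ?_⟩
  · rw [Perm.subtypePerm_pow]
    ext v
    simp [hσ.1]
  · simpa using congrArg Subtype.val hv

lemma card_fpfRootsOn_le (p : ℕ) (S : Finset V) :
    (fpfRootsOn p S).card ≤
      (fpfRoots p {v // v ∈ S}).card * (fpfRoots p {v // v ∉ S}).card := by
  rw [← Finset.card_product]
  have hc : ∀ σ : fpfRootsOn p S, ∀ v, σ.1 v ∉ S ↔ v ∉ S := fun σ v =>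
    not_congr ((mem_fpfRootsOn.1 σ.2).2 v)
  rw [← Finset.card_attach]
  refine Finset.card_le_card_of_injOn (fun σ => (σ.1.subtypePerm (mem_fpfRootsOn.1 σ.2).2,
    σ.1.subtypePerm (hc σ))) ?_ ?_
  · intro σ _
    have h := (mem_fpfRootsOn.1 σ.2).1
    rw [Finset.mem_coe, Finset.mem_product]
    exact ⟨subtypePerm_mem_fpfRoots h (mem_fpfRootsOn.1 σ.2).2, subtypePerm_mem_fpfRoots h (hc σ)⟩
  · rintro ⟨σ, hσ⟩ _ ⟨τ, hτ⟩ _ h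
    simp only [Prod.mk.injEq] at h
    obtain ⟨h1, h2⟩ := h
    rw [Subtype.mk.injEq]
    ext v
    by_cases hv : v ∈ S
    · simpa using congrArg Subtype.val (Perm.congr_fun h1 ⟨v, hv⟩)
    · simpa using congrArg Subtype.val (Perm.congr_fun h2 ⟨v, hv⟩)

-- A root preserving `S` splits into roots on `S` and on its complement. Dividing the three
-- factorial formulas cancels the powers of `p` and leaves a quotient of binomials.
open Nat in
lemma card_fpfRootsOn_mul_choose_le {p k i : ℕ} (hp : p.Prime) (hV : Fintype.card V = p * k)
    {S : Finset V} (hi : i ≤ k) (hS : S.card = p * i) :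
    (fpfRootsOn p S).card * (p * k).choose (p * i) ≤ (fpfRoots p V).card * k.choose i := by
  have hS1 : Fintype.card {v // v ∈ S} = p * i := by rw [Fintype.card_coe, hS]
  have hS2 : Fintype.card {v // v ∉ S} = p * (k - i) := by
    rw [Fintype.card_subtype_compl, hV, hS1, Nat.mul_sub]
  have h1 := card_fpfRoots_mul hp hS1
  have h2 := card_fpfRoots_mul hp hS2
  have h0 := card_fpfRoots_mul hp hV
  have h3 := Nat.choose_mul_factorial_mul_factorial hi
  have h4 := Nat.choose_mul_factorial_mul_factorial (Nat.mul_le_mul_left p hi)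
  rw [← Nat.mul_sub] at h4
  have h5 : p ^ i * p ^ (k - i) = p ^ k := by rw [← pow_add, Nat.add_sub_cancel' hi]
  have hpos : 0 < p ^ k * (i ! * (k - i)!) := by have := hp.pos; positivity
  refine Nat.le_of_mul_le_mul_right ?_ hpos
  calc _ ≤ (fpfRoots p {v // v ∈ S}).card * (fpfRoots p {v // v ∉ S}).card *
        (p * k).choose (p * i) * (p ^ k * (i ! * (k - i)!)) := by
        gcongr; exact card_fpfRootsOn_le p S
    _ = (p * k).choose (p * i) * ((fpfRoots p {v // v ∈ S}).card * (p ^ i * i !)) *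
        ((fpfRoots p {v // v ∉ S}).card * (p ^ (k - i) * (k - i)!)) := by rw [← h5]; ring
    _ = (fpfRoots p V).card * (p ^ k * (k.choose i * i ! * (k - i)!)) := by
        rw [h1, h2, h4, h3, h0]
    _ = _ := by ring

lemma choose_mul_choose_le_add (a b c d : ℕ) :
    a.choose c * b.choose d ≤ (a + b).choose (c + d) := by
  rw [Nat.add_choose_eq]
  exact Finset.single_le_sum (f := fun ij : ℕ × ℕ => a.choose ij.1 * b.choose ij.2)
    (fun _ _ => Nat.zero_le _) (a := (c, d)) (Finset.HasAntidiagonal.mem_antidiagonal.2 rfl)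

lemma le_choose_of_pos_of_lt {r l : ℕ} (h0 : 0 < l) (h1 : l < r) : r ≤ r.choose l := by
  induction r generalizing l with
  | zero => omega
  | succ r ih =>
    obtain ⟨l, rfl⟩ : ∃ k, l = k + 1 := ⟨l - 1, by omega⟩
    rw [Nat.choose_succ_succ']
    have h2 := Nat.choose_pos (by omega : l ≤ r)
    have h3 := Nat.choose_pos (by omega : l + 1 ≤ r)
    rcases Nat.lt_or_ge (l + 1) r with h | h
    · have := ih (l := l + 1) (by omega) h
      omega
    · have : r = l + 1 := by omega
      subst this
      simp

/-- The two quotients multiply to C(3r,3l) C(2r,2l) / C(6r,6l)². Vandermonde gives C(6r,6l) ≥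
C(3r,3l)² and C(3r,3l) ≥ C(2r,2l) C(r,l), and C(r,l) ≥ r. -/
lemma card_fpfRootsOn_two_mul_three_le {r l : ℕ} (hV : Fintype.card V = 6 * r) {S : Finset V}
    (h0 : 0 < l) (h1 : l < r) (hS : S.card = 6 * l) :
    (fpfRootsOn 2 S).card * (fpfRootsOn 3 S).card * ((6 * r).choose (6 * l) * r) ≤
      (fpfRoots 2 V).card * (fpfRoots 3 V).card := by
  have h2 := card_fpfRootsOn_mul_choose_le Nat.prime_two (k := 3 * r) (i := 3 * l)
    (by omega : _ = 2 * (3 * r)) (S := S) (by omega) (by omega)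
  have h3 := card_fpfRootsOn_mul_choose_le Nat.prime_three (k := 2 * r) (i := 2 * l)
    (by omega : _ = 3 * (2 * r)) (S := S) (by omega) (by omega)
  rw [show 2 * (3 * r) = 6 * r by ring, show 2 * (3 * l) = 6 * l by ring] at h2
  rw [show 3 * (2 * r) = 6 * r by ring, show 3 * (2 * l) = 6 * l by ring] at h3
  have h4 := choose_mul_choose_le_add (3 * r) (3 * r) (3 * l) (3 * l)
  have h5 := choose_mul_choose_le_add (2 * r) r (2 * l) l
  rw [show 3 * r + 3 * r = 6 * r by ring, show 3 * l + 3 * l = 6 * l by ring] at h4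
  rw [show 2 * r + r = 3 * r by ring, show 2 * l + l = 3 * l by ring] at h5
  have h6 := le_choose_of_pos_of_lt h0 h1
  have p1 := Nat.choose_pos (by omega : 2 * l ≤ 2 * r)
  have p2 := Nat.choose_pos (by omega : 3 * l ≤ 3 * r)
  have p3 := Nat.choose_pos (by omega : 6 * l ≤ 6 * r)
  generalize (6 * r).choose (6 * l) = X at *
  generalize (3 * r).choose (3 * l) = Y at *
  generalize (2 * r).choose (2 * l) = Z at *
  generalize r.choose l = W at *
  generalize (fpfRootsOn 2 S).card = A at *
  generalize (fpfRootsOn 3 S).card = B at *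
  generalize (fpfRoots 2 V).card = F at *
  generalize (fpfRoots 3 V).card = G at *
  refine Nat.le_of_mul_le_mul_right ?_ (Nat.mul_pos p1 p2)
  calc A * B * (X * r) * (Z * Y) ≤ A * B * (X * W) * (Z * Y) := by gcongr
    _ = A * B * X * (Z * W) * Y := by ring
    _ ≤ A * B * X * Y * Y := by gcongr
    _ = A * B * X * (Y * Y) := by ring
    _ ≤ A * B * X * X := by gcongr
    _ = (A * X) * (B * X) := by ring
    _ ≤ (F * Y) * (G * Z) := by gcongr
    _ = F * G * (Z * Y) := by ring

/-- For each `l` the C(6r,6l) sets of size 6l contribute in total at most a fraction 1/r of all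
pairs, and there are only r - 1 values of `l`. -/
lemma sum_card_fpfRootsOn_le {r : ℕ} (hV : Fintype.card V = 6 * r) (hr : 0 < r) :
    ∑ S ∈ (Finset.univ : Finset (Finset V)).filter (fun S => S ≠ ∅ ∧ S ≠ Finset.univ),
      (fpfRootsOn 2 S).card * (fpfRootsOn 3 S).card ≤
      (fpfRoots 2 V).card * (fpfRoots 3 V).card := by
  have key : ∀ l ∈ Finset.Ico 1 r, ∑ S ∈ Finset.powersetCard (6 * l) (Finset.univ : Finset V),
      r * ((fpfRootsOn 2 S).card * (fpfRootsOn 3 S).card) ≤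
      (fpfRoots 2 V).card * (fpfRoots 3 V).card := by
    intro l hl
    rw [Finset.mem_Ico] at hl
    have p3 := Nat.choose_pos (by omega : 6 * l ≤ 6 * r)
    refine Nat.le_of_mul_le_mul_left ?_ p3
    rw [Finset.mul_sum]
    refine (Finset.sum_le_card_nsmul _ _ ((fpfRoots 2 V).card * (fpfRoots 3 V).card)
      fun S hS => ?_).trans ?_
    · have := card_fpfRootsOn_two_mul_three_le hV hl.1 hl.2 (Finset.mem_powersetCard.1 hS).2
      linarith
    · rw [Finset.card_powersetCard, Finset.card_univ, hV, smul_eq_mul]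
  have hsub : ∑ S ∈ (Finset.univ : Finset (Finset V)).filter
        (fun S => S ≠ ∅ ∧ S ≠ Finset.univ), r * ((fpfRootsOn 2 S).card * (fpfRootsOn 3 S).card) ≤
      ∑ S ∈ (Finset.Ico 1 r).biUnion fun l => Finset.powersetCard (6 * l) (Finset.univ : Finset V),
        r * ((fpfRootsOn 2 S).card * (fpfRootsOn 3 S).card) := by
    refine Finset.sum_le_sum_of_ne_zero fun S hS hne => ?_
    have h2 : (fpfRootsOn 2 S).card ≠ 0 := fun h => hne (by simp [h])
    have h3 : (fpfRootsOn 3 S).card ≠ 0 := fun h => hne (by simp [h])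
    have hdvd : ∀ p : ℕ, p.Prime → (fpfRootsOn p S).card ≠ 0 → p ∣ S.card := by
      intro p hp h
      obtain ⟨σ, hσ⟩ := Finset.card_ne_zero.1 h
      rw [mem_fpfRootsOn] at hσ
      have := dvd_card_of_mem_fpfRoots hp (subtypePerm_mem_fpfRoots hσ.1 hσ.2)
      rwa [Fintype.card_coe] at this
    have d2 := hdvd 2 Nat.prime_two h2
    have d3 := hdvd 3 Nat.prime_three h3
    obtain ⟨l, hl⟩ : 6 ∣ S.card := by omega
    obtain ⟨-, hS1, hS2⟩ := Finset.mem_filter.1 hS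
    have c1 : 0 < S.card := Finset.card_pos.2 (Finset.nonempty_iff_ne_empty.2 hS1)
    have c2 : S.card < Fintype.card V := Finset.card_lt_univ_of_notMem
      (Classical.not_forall.1 fun h => hS2 (Finset.eq_univ_iff_forall.2 h)).choose_spec
    rw [Finset.mem_biUnion]
    exact ⟨l, Finset.mem_Ico.2 (by omega), Finset.mem_powersetCard.2 ⟨Finset.subset_univ _, hl⟩⟩
  rw [Finset.sum_biUnion fun i _ j _ hij => Finset.pairwise_disjoint_powersetCard _
    (by omega : 6 * i ≠ 6 * j)] at hsub
  have hfin := hsub.trans (Finset.sum_le_card_nsmul _ _ _ key)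
  rw [← Finset.mul_sum, Nat.card_Ico, smul_eq_mul] at hfin
  refine Nat.le_of_mul_le_mul_left (hfin.trans ?_) hr
  gcongr
  omega

/-- The graph with an edge between `v` and each of `a v`, `b v`. -/
def permGraph (a b : Perm V) : SimpleGraph V := SimpleGraph.fromRel fun u v => a u = v ∨ b u = v

lemma exists_invariant_of_not_connected [Nonempty V] {a b : Perm V}
    (h : ¬ (permGraph a b).Connected) : ∃ S : Finset V, S ≠ ∅ ∧ S ≠ Finset.univ ∧
      (∀ v, a v ∈ S ↔ v ∈ S) ∧ ∀ v, b v ∈ S ↔ v ∈ S := by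
  classical
  have h1 : ¬ (permGraph a b).Preconnected := fun h' => h ⟨h'⟩
  unfold SimpleGraph.Preconnected at h1
  push Not at h1
  obtain ⟨u, v, huv⟩ := h1
  have hr : ∀ x y, (a x = y ∨ b x = y) → (permGraph a b).Reachable x y := by
    intro x y hxy
    by_cases hne : x = y
    · exact hne ▸ SimpleGraph.Reachable.refl _
    · exact SimpleGraph.Adj.reachable ((SimpleGraph.fromRel_adj _ _ _).2 ⟨hne, Or.inl hxy⟩)
  refine ⟨Finset.univ.filter fun x => (permGraph a b).Reachable u x, ?_, ?_, ?_, ?_⟩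
  · exact Finset.ne_empty_of_mem (a := u) (by simp)
  · intro h'
    have : v ∈ (Finset.univ : Finset V) := Finset.mem_univ v
    rw [← h'] at this
    exact huv (Finset.mem_filter.1 this).2
  · intro x
    have := hr x (a x) (Or.inl rfl)
    simp only [Finset.mem_filter, Finset.mem_univ, true_and]
    exact ⟨fun h => h.trans this.symm, fun h => h.trans this⟩
  · intro x
    have := hr x (b x) (Or.inr rfl)
    simp only [Finset.mem_filter, Finset.mem_univ, true_and]
    exact ⟨fun h => h.trans this.symm, fun h => h.trans this⟩

open Classical in
/-- At most half of all pairs of permutations give a disconnected graph. -/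
lemma two_mul_card_not_connected_le {r : ℕ} (hV : Fintype.card V = 6 * r) (hr : 0 < r) :
    2 * ((fpfRoots 2 V ×ˢ fpfRoots 3 V).filter fun x => ¬ (permGraph x.1 x.2).Connected).card ≤
      (fpfRoots 2 V).card * (fpfRoots 3 V).card := by
  have hne : Nonempty V := Fintype.card_pos_iff.1 (by omega)
  refine le_trans ?_ (sum_card_fpfRootsOn_le hV hr)
  let inv : Perm V × Perm V → Finset V → Prop := fun x S =>
    (∀ v, x.1 v ∈ S ↔ v ∈ S) ∧ ∀ v, x.2 v ∈ S ↔ v ∈ S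
  have h1 := Finset.sum_card_bipartiteAbove_eq_sum_card_bipartiteBelow inv
    (s := (fpfRoots 2 V ×ˢ fpfRoots 3 V).filter fun x => ¬ (permGraph x.1 x.2).Connected)
    (t := (Finset.univ : Finset (Finset V)).filter (fun S => S ≠ ∅ ∧ S ≠ Finset.univ))
  have h2 : ∀ S ∈ (Finset.univ : Finset (Finset V)).filter (fun S => S ≠ ∅ ∧ S ≠ Finset.univ),
      (Finset.bipartiteBelow inv ((fpfRoots 2 V ×ˢ fpfRoots 3 V).filter
        fun x => ¬ (permGraph x.1 x.2).Connected) S).card ≤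
      (fpfRootsOn 2 S).card * (fpfRootsOn 3 S).card := by
    intro S _
    rw [← Finset.card_product]
    refine Finset.card_le_card fun x hx => ?_
    rw [Finset.mem_bipartiteBelow, Finset.mem_filter, Finset.mem_product] at hx
    rw [Finset.mem_product, mem_fpfRootsOn, mem_fpfRootsOn]
    exact ⟨⟨hx.1.1.1, hx.2.1⟩, hx.1.1.2, hx.2.2⟩
  refine le_trans ?_ (Finset.sum_le_sum h2)
  rw [← h1, mul_comm, ← smul_eq_mul]
  refine Finset.card_nsmul_le_sum _ _ _ fun x hx => ?_
  obtain ⟨S, hS1, hS2, hSa, hSb⟩ := exists_invariant_of_not_connected (Finset.mem_filter.1 hx).2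
  -- An invariant set and its complement are both counted, which gives the factor 2.
  have hSc : S ≠ Sᶜ := fun h => by
    obtain ⟨v⟩ := hne
    have h' := Finset.mem_compl (s := S) (a := v)
    rw [← h] at h'
    tauto
  rw [← Finset.card_pair hSc]
  refine Finset.card_le_card fun T hT => ?_
  rw [Finset.mem_bipartiteAbove, Finset.mem_filter]
  rw [Finset.mem_insert, Finset.mem_singleton] at hT
  rcases hT with rfl | rfl
  · exact ⟨⟨Finset.mem_univ _, hS1, hS2⟩, hSa, hSb⟩
  · refine ⟨⟨Finset.mem_univ _, ?_, ?_⟩, fun v => ?_, fun v => ?_⟩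
    · simpa using hS2
    · simpa using hS1
    · simp [hSa]
    · simp [hSb]

end Counting

/-! ### From pairs of permutations to silhouette graphs -/

section Main

namespace SilhouetteGraph

/-- The pair of permutations of a silhouette graph. -/
def perms {n : ℕ} (G : SilhouetteGraph n) : Perm (Fin n) × Perm (Fin n) := (G.a, G.b)

lemma perms_injective (n : ℕ) : Function.Injective (perms (n := n)) := fun G H h => by
  simp only [perms, Prod.mk.injEq] at h
  exact SilhouetteGraph.ext h.1 h.2

lemma card_pairs_le {n : ℕ} (hn : 0 < n) (h6 : 6 ∣ n) :
    (fpfRoots 2 (Fin n)).card * (fpfRoots 3 (Fin n)).card ≤ 2 * Nat.card (SilhouetteGraph n) := by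
  classical
  obtain ⟨r, rfl⟩ := h6
  have h1 := two_mul_card_not_connected_le (V := Fin (6 * r)) (r := r) (by simp) (by omega)
  have h2 := Finset.card_filter_add_card_filter_not (s := fpfRoots 2 (Fin (6 * r)) ×ˢ
    fpfRoots 3 (Fin (6 * r))) (fun x => (permGraph x.1 x.2).Connected)
  rw [Finset.card_product] at h2
  have h3 : ((fpfRoots 2 (Fin (6 * r)) ×ˢ fpfRoots 3 (Fin (6 * r))).filter
      fun x => (permGraph x.1 x.2).Connected).card ≤ Nat.card (SilhouetteGraph (6 * r)) := by
    rw [← Set.ncard_univ, ← Set.ncard_image_of_injective _ (perms_injective (6 * r)),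
      ← Set.ncard_coe_finset]
    refine Set.ncard_le_ncard ?_ (Set.toFinite _)
    rintro ⟨a, b⟩ hx
    rw [Finset.mem_coe, Finset.mem_filter, Finset.mem_product, mem_fpfRoots, mem_fpfRoots] at hx
    exact ⟨⟨a, b, hx.1.1.1, hx.1.1.2, hx.1.2.1, hx.1.2.2, hx.2⟩, Set.mem_univ _, rfl⟩
  omega

/-- Dropping connectedness only enlarges the set being counted; the bound for a fixed `b` is then
summed over all `b`. -/
lemma ncard_no_short_le {n M : ℕ} (hM : 1 ≤ M) (hMn : M ^ 3 ≤ n) {E : Set (SilhouetteGraph n)}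
    (hE : ∀ G ∈ E, ∀ m, 2 ≤ m → m ≤ M → ¬ G.HasABCycle m) :
    (M + 1) * E.ncard ≤ 106 * ((fpfRoots 2 (Fin n)).card * (fpfRoots 3 (Fin n)).card) := by
  have h1 : E.ncard ≤ ((fpfRoots 3 (Fin n)).sigma fun b => noShort b M).card := by
    rw [← Set.ncard_coe_finset, ← Set.ncard_image_of_injective E
      (f := fun G => (⟨G.b, G.a⟩ : (_ : Perm (Fin n)) × Perm (Fin n)))]
    · refine Set.ncard_le_ncard ?_ (Set.toFinite _)
      rintro _ ⟨G, hG, rfl⟩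
      rw [Finset.mem_coe, Finset.mem_sigma, mem_fpfRoots, mem_noShort, mem_fpfRoots]
      refine ⟨⟨G.b_cube, G.b_ne⟩, ⟨G.a_sq, G.a_ne⟩, fun v k h2 hk hv => ?_⟩
      exact hE G hG k h2 hk ⟨by omega, v, hv⟩
    · intro G H h
      simp only [Sigma.mk.injEq, heq_eq_eq] at h
      exact SilhouetteGraph.ext h.2 h.1
  calc _ ≤ (M + 1) * ((fpfRoots 3 (Fin n)).sigma fun b => noShort b M).card := by gcongr
    _ = ∑ b ∈ fpfRoots 3 (Fin n), (M + 1) * (noShort b M).card := by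
      rw [Finset.card_sigma, Finset.mul_sum]
    _ ≤ (fpfRoots 3 (Fin n)).card • (106 * (fpfRoots 2 (Fin n)).card) := by
      refine Finset.sum_le_card_nsmul _ _ _ fun b hb => ?_
      obtain ⟨h3, hf⟩ := mem_fpfRoots.1 hb
      exact card_noShort_le h3 hf hM (by simpa using hMn)
    _ = _ := by rw [smul_eq_mul]; ring

lemma card_pos {n : ℕ} (hn : 0 < n) (h6 : 6 ∣ n) : 0 < Nat.card (SilhouetteGraph n) := by
  have h := card_pairs_le hn h6
  obtain ⟨r, rfl⟩ := h6
  have h2 := card_fpfRoots_mul (V := Fin (6 * r)) Nat.prime_two (k := 3 * r) (by simp; ring)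
  have h3 := card_fpfRoots_mul (V := Fin (6 * r)) Nat.prime_three (k := 2 * r) (by simp; ring)
  have p2 : 0 < (fpfRoots 2 (Fin (6 * r))).card :=
    Nat.pos_of_ne_zero fun h0 => by rw [h0, zero_mul] at h2; exact Nat.factorial_ne_zero _ h2.symm
  have p3 : 0 < (fpfRoots 3 (Fin (6 * r))).card :=
    Nat.pos_of_ne_zero fun h0 => by rw [h0, zero_mul] at h3; exact Nat.factorial_ne_zero _ h3.symm
  have := Nat.mul_pos p2 p3
  omega

end SilhouetteGraph

theorem mainTheorem4 (α : ℝ) (hα0 : 0 < α) (hα : α < 1 / 6) :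
    ∃ C : ℝ, 0 < C ∧ ∀ n : ℕ, 0 < n → 6 ∣ n →
      1 - C * (n : ℝ) ^ (-α) ≤
        SilhouetteGraph.prob n
          {G | ∃ m : ℕ, 2 ≤ m ∧ (m : ℝ) ≤ (n : ℝ) ^ α ∧ G.HasABCycle m} := by
  -- 212 = 2 · 106: the factor 2 is the price of conditioning on connectedness.
  refine ⟨212, by norm_num, fun n hn h6 => ?_⟩
  have hn1 : (1 : ℝ) ≤ n := by exact_mod_cast hn
  set E : Set (SilhouetteGraph n) :=
    {G | ∃ m : ℕ, 2 ≤ m ∧ (m : ℝ) ≤ (n : ℝ) ^ α ∧ G.HasABCycle m} with hE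
  set M := ⌊(n : ℝ) ^ α⌋₊ with hM
  have hpos : (0 : ℝ) < (n : ℝ) ^ α := Real.rpow_pos_of_pos (by linarith) _
  have hMle : (M : ℝ) ≤ (n : ℝ) ^ α := Nat.floor_le hpos.le
  have hM1 : 1 ≤ M := by
    rw [hM, Nat.one_le_floor_iff]
    exact Real.one_le_rpow hn1 hα0.le
  have hM3 : M ^ 3 ≤ n := by
    have h : (M : ℝ) ^ 3 ≤ n := calc
      (M : ℝ) ^ 3 ≤ ((n : ℝ) ^ α) ^ 3 := by gcongr
      _ = (n : ℝ) ^ (α * 3) := by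
        rw [Real.rpow_mul (by linarith)]; norm_cast
      _ ≤ (n : ℝ) ^ (1 : ℝ) := Real.rpow_le_rpow_of_exponent_le hn1 (by linarith)
      _ = n := Real.rpow_one _
    exact_mod_cast h
  have h1 : (M + 1) * Eᶜ.ncard ≤ 212 * Nat.card (SilhouetteGraph n) := by
    have h2 := SilhouetteGraph.ncard_no_short_le hM1 hM3 (E := Eᶜ) fun G hG m h2 hm hc =>
      hG ⟨m, h2, le_trans (by exact_mod_cast hm) hMle, hc⟩
    have h3 := SilhouetteGraph.card_pairs_le hn h6
    linarith
  have hN : (0 : ℝ) < Nat.card (SilhouetteGraph n) := by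
    exact_mod_cast SilhouetteGraph.card_pos hn h6
  have hsum : (E.ncard : ℝ) + Eᶜ.ncard = Nat.card (SilhouetteGraph n) := by
    exact_mod_cast Set.ncard_add_ncard_compl E
  have h1' : ((M : ℝ) + 1) * Eᶜ.ncard ≤ 212 * Nat.card (SilhouetteGraph n) := by
    exact_mod_cast h1
  have hMlt : (n : ℝ) ^ α ≤ (M : ℝ) + 1 := (Nat.lt_floor_add_one _).le
  have h4 : (n : ℝ) ^ α * Eᶜ.ncard ≤ 212 * Nat.card (SilhouetteGraph n) :=
    (mul_le_mul_of_nonneg_right hMlt (Nat.cast_nonneg _)).trans h1'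
  rw [SilhouetteGraph.prob, le_div_iff₀ hN, Real.rpow_neg (by linarith)]
  have h5 : (Eᶜ.ncard : ℝ) ≤ 212 * ((n : ℝ) ^ α)⁻¹ * Nat.card (SilhouetteGraph n) := by
    rw [mul_right_comm, ← div_eq_mul_inv, le_div_iff₀ hpos]
    linarith
  linarith

end Main
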